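/- Let $r\ge 1$ be an integer, $\mathbb N=\{0,1,2,\dots\}$, and for $\vec n=(n_1,\dots,n_r)\in\mathbb N^r$ put $|\vec n|=n_1+\dots+n_r$. Let $\vec e_i$ denote the $i$-th standard unit vector (with $1$ in the $i$-th entry and $0$ elsewhere). **Multiple Laguerre polynomials.** (First kind.) Let $\vec\alpha=(\alpha_1,\dots,\alpha_r)\in\mathbb R^r$ with $\alpha_j>-1$ for all $j$ and $\alpha_i-\alpha_j\notin\mathbb Z$ whenever $i\ne j$. Then for every $\vec n\in\mathbb N^r$ there is exactly one monic real polynomial $L_{\vec n}^{\vec\alpha}$ of degree $|\vec n|$ such that $$\int_0^\infty x^k L_{\vec n}^{\vec\alpha}(x)\,x^{\alpha_j}e^{-x}\,dx=0,\qquad k=0,1,\dots,n_j-1,\quad j=1,\dots,r.$$ (Second kind.) Let $\alpha>-1$ and $\vec c=(c_1,\dots,c_r)$ with $c_j>0$ for all $j$ and $c_i\neq c_j$ whenever $i\ne j$. Then for every $\vec n\in\mathbb N^r$ there is exactly one monic real polynomial $L_{\vec n}^{(\alpha,\vec c)}$ of degree $|\vec n|$ such that $$\int_0^\infty x^k L_{\vec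 n}^{(\alpha,\vec c)}(x)\,x^{\alpha}e^{-c_jx}\,dx=0,\qquad k=0,1,\dots,n_j-1,\quad j=1,\dots,r.$$ **Two-parameter Turán inequalities.** (1) Let $\vec\alpha$ be as in the first kind and suppose in addition that $\alpha_i>0$ for all $i$. Then for all $\vec n\in\mathbb N^r$, all $j,k\in\{1,\dots,r\}$ and all $x>0$, $$L_{\vec n+\vec e_k}^{\vec\alpha}(x)\,L_{\vec n+\vec e_j}^{\vec\alpha-\vec e_j}(x)-L_{\vec n}^{\vec\alpha}(x)\,L_{\vec n+\vec e_j+\vec e_k}^{\vec\alpha-\vec e_j}(x)>0.$$ (2) Let $\alpha,\vec c$ be as in the second kind and suppose in addition that $\alpha>0$. Then for all $\vec n\in\mathbb N^r$, all $j,k\in\{1,\dots,r\}$ and all $x>0$, $$L_{\vec n+\vec e_k}^{(\alpha,\vec c)}(x)\,L_{\vec n+\vec e_j}^{(\alpha-1,\vec c)}(x)-L_{\vec n}^{(\alpha,\vec c)}(x)\,L_{\vec n+\vec e_j+\vec e_k}^{(\alpha-1,\vec c)}(x)>0.$$ -/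

import Mathlib

open MeasureTheory Polynomial

noncomputable section

/-- `P` is a type II multiple orthogonal polynomial of multi-index `n` for the weights
`w 0, …, w (r - 1)` on the half-line `(0, ∞)`: it is monic of degree `|n| = ∑ j, n j`, and
`∫₀^∞ x ^ k P(x) w_j(x) dx = 0` for all `j` and `k = 0, 1, …, n_j - 1`. -/
def IsTypeIIOrthogonal {r : ℕ} (w : Fin r → ℝ → ℝ) (n : Fin r → ℕ) (P : ℝ[X]) : Prop :=
  P.Monic ∧ P.natDegree = ∑ j, n j ∧
    ∀ j : Fin r, ∀ k : ℕ, k < n j → ∫ x in Set.Ioi (0 : ℝ), x ^ k * P.eval x * w j x = 0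

/-- The weights `x ^ α_j e ^ (-x)`. -/
def laguerreWeightFirst {r : ℕ} (α : Fin r → ℝ) (j : Fin r) (x : ℝ) : ℝ :=
  x ^ α j * Real.exp (-x)

/-- The weights `x ^ α e ^ (-c_j x)`. -/
def laguerreWeightSecond {r : ℕ} (α : ℝ) (c : Fin r → ℝ) (j : Fin r) (x : ℝ) : ℝ :=
  x ^ α * Real.exp (-(c j * x))

/-- The multiple Laguerre polynomial of the first kind: the type II multiple orthogonal
polynomial for the weights `x ^ α_j e ^ (-x)` (an arbitrary value if there is none). -/
def multipleLaguerreFirst {r : ℕ} (α : Fin r → ℝ) (n : Fin r → ℕ) : ℝ[X] :=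
  Classical.epsilon (IsTypeIIOrthogonal (laguerreWeightFirst α) n)

/-- The multiple Laguerre polynomial of the second kind: the type II multiple orthogonal
polynomial for the weights `x ^ α e ^ (-c_j x)` (an arbitrary value if there is none). -/
def multipleLaguerreSecond {r : ℕ} (α : ℝ) (c : Fin r → ℝ) (n : Fin r → ℕ) : ℝ[X] :=
  Classical.epsilon (IsTypeIIOrthogonal (laguerreWeightSecond α c) n)

/-- The `i`-th standard unit multi-index `e_i`. -/
def unitIndex {r : ℕ} (i : Fin r) : Fin r → ℕ := Pi.single i 1

/-- The `i`-th standard unit vector `e_i` with real entries. -/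
def unitVector {r : ℕ} (i : Fin r) : Fin r → ℝ := Pi.single i 1

end

/-! Let `A`, `B` be the polynomials of indices `n` and `n + e_k` for the unshifted weights. In both
families an operator `raise a b`, that is `L ↦ (X - a) L - b X L'` with `b > 0`, sends the
polynomial of index `n` to the one of index `n + e_j` for the shifted weights, with `a`, `b`
independent of `n`. Substituting the raised `A` and `B`, the terms with `x - a` cancel and the Turán
expression becomes `b x (A B' - A' B)(x)`. Hence it suffices that the Wronskian is positive on `(0,
∞)` (`eval_wronskian_pos`).

Its leading coefficient is 1, so it only has to be nonzero. If it vanished at `x > 0`, a nontrivial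
combination of `A` and `B` would have a double zero at `x`. That combination has degree at most `|n|
+ 1` and satisfies the orthogonality conditions of index `n`, which force at least `|n|` sign
changes; the single remaining degree leaves no room for a double zero (`eq_zero_of_double_zero`).

The sign changes come from the Chebyshev property: a combination `∑ pⱼ wⱼ` with `deg pⱼ < nⱼ` has
fewer than `|n|` positive zeros, so one can be built that changes sign exactly at fewer than `|n|`
given points. The same count gives existence and uniqueness. For Laguerre weights the property
reduces to Rolle's theorem for exponential polynomials (`card_zeros_expPolynomial_lt`). -/

/-! ### Zeros of exponential polynomials -/

/-- Counting form of Rolle's theorem: zeros of `g` on `S`, of order at least two on `T ⊆ S`, force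
`#S + #T - 1` zeros of the derivative. -/
theorem exists_finset_deriv_eq_zero {g : ℝ → ℝ} (hg : Differentiable ℝ g) {S T : Finset ℝ}
    (hTS : T ⊆ S) (hS : ∀ x ∈ S, g x = 0) (hT : ∀ x ∈ T, deriv g x = 0) :
    ∃ U : Finset ℝ, (∀ x ∈ U, deriv g x = 0) ∧ S.card + T.card ≤ U.card + 1 := by
  -- The Rolle points avoid `S`, hence `T`, so the two sets of zeros add up. The bound `v < s`
  -- places the old points below the next one.
  have key : ∃ V : Finset ℝ, (∀ v ∈ V, deriv g v = 0 ∧ v ∉ S ∧ ∃ s ∈ S, v < s) ∧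
      S.card ≤ V.card + 1 := by
    clear hT hTS
    induction S using Finset.induction_on_max with
    | empty => exact ⟨∅, by simp, by simp⟩
    | insert a S ha ih =>
      obtain ⟨V, hV, hc⟩ := ih fun x hx => hS x (Finset.mem_insert_of_mem hx)
      have haS : a ∉ S := fun h => lt_irrefl _ (ha a h)
      rcases S.eq_empty_or_nonempty with rfl | hne
      · exact ⟨∅, by simp, by simp⟩
      · have hm := S.max'_mem hne
        have hlt := ha _ hm
        obtain ⟨v, ⟨hv1, hv2⟩, hv⟩ := exists_deriv_eq_zero hlt hg.continuous.continuousOn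
          ((hS _ (Finset.mem_insert_of_mem hm)).trans (hS a (Finset.mem_insert_self _ _)).symm)
        have hvV : v ∉ V := by
          intro h
          obtain ⟨-, -, s, hs, hvs⟩ := hV v h
          exact absurd (S.le_max' s hs) (not_le.2 (hv1.trans hvs))
        refine ⟨insert v V, ?_, ?_⟩
        · intro u hu
          rcases Finset.mem_insert.1 hu with rfl | hu
          · refine ⟨hv, ?_, a, Finset.mem_insert_self _ _, hv2⟩
            intro h
            rcases Finset.mem_insert.1 h with h | h
            · exact hv2.ne h
            · exact absurd (S.le_max' _ h) (not_le.2 hv1)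
          · obtain ⟨h1, h2, s, hs, hus⟩ := hV u hu
            refine ⟨h1, ?_, s, Finset.mem_insert_of_mem hs, hus⟩
            intro h
            rcases Finset.mem_insert.1 h with h | h
            · exact absurd (hus.trans (ha s hs)) (by rw [h]; exact lt_irrefl _)
            · exact h2 h
        · rw [Finset.card_insert_of_notMem haS, Finset.card_insert_of_notMem hvV]
          omega
  obtain ⟨V, hV, hc⟩ := key
  refine ⟨V ∪ T, ?_, ?_⟩
  · intro x hx
    rcases Finset.mem_union.1 hx with h | h
    · exact (hV x h).1
    · exact hT x h
  · rw [Finset.card_union_of_disjoint]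
    · omega
    · rw [Finset.disjoint_left]
      exact fun x hx hx' => (hV x hx).2.1 (hTS hx')

theorem Polynomial.eq_zero_of_derivative_add_C_mul_eq_zero {p : ℝ[X]} {μ : ℝ} (hμ : μ ≠ 0)
    (h : derivative p + C μ * p = 0) : p = 0 := by
  by_contra hp
  have h1 : (C μ * p).degree = p.degree := degree_C_mul hμ
  have h2 : (C μ * p).degree = (derivative p).degree := by
    rw [eq_neg_of_add_eq_zero_right h, degree_neg]
  exact absurd (degree_derivative_lt hp) (by rw [← h2, h1]; exact lt_irrefl _)

theorem hasDerivAt_expPolynomial {ι : Type*} [Fintype ι] (p : ι → ℝ[X]) (l : ι → ℝ) (t : ℝ) :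
    HasDerivAt (fun t => ∑ i, (p i).eval t * Real.exp (l i * t))
      (∑ i, (derivative (p i) + C (l i) * p i).eval t * Real.exp (l i * t)) t := by
  refine HasDerivAt.fun_sum fun i _ => ?_
  have h1 : HasDerivAt (fun t : ℝ => Real.exp (l i * t)) (Real.exp (l i * t) * (l i * 1)) t :=
    ((hasDerivAt_id t).const_mul (l i)).exp
  refine (((p i).hasDerivAt t).mul h1).congr_deriv ?_
  simp only [eval_add, eval_mul, eval_C]
  ring

/-- A nontrivial exponential polynomial `∑ pᵢ(t) e^(lᵢ t)` with `deg pᵢ < nᵢ` has fewer than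
`∑ nᵢ` real zeros, even if some of the double zeros are counted twice. -/
theorem card_zeros_expPolynomial_lt {ι : Type*} [Fintype ι] [DecidableEq ι] (N : ℕ) :
    ∀ (n : ι → ℕ) (p : ι → ℝ[X]) (l : ι → ℝ), Function.Injective l →
      (∀ i, (p i).degree < n i) → p ≠ 0 → ∑ i, n i = N → ∀ S T : Finset ℝ, T ⊆ S →
      (∀ t ∈ S, ∑ i, (p i).eval t * Real.exp (l i * t) = 0) →
      (∀ t ∈ T, deriv (fun t => ∑ i, (p i).eval t * Real.exp (l i * t)) t = 0) →
      S.card + T.card < N := by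
  induction N with
  | zero =>
    intro n p l _ hdeg hp hN
    refine absurd (funext fun i => ?_) hp
    have : n i = 0 := by
      rw [Finset.sum_eq_zero_iff] at hN
      exact hN i (Finset.mem_univ i)
    have h := hdeg i
    rw [this, Nat.cast_zero] at h
    exact degree_eq_bot.1 (Nat.WithBot.lt_zero_iff.1 h)
  | succ N ih =>
    intro n p l hl hdeg hp hN S T hTS hS hT
    obtain ⟨i, hi⟩ := Function.ne_iff.1 hp
    have hni : n i ≠ 0 := fun h => hi <| by
      have h' := hdeg i
      rw [h, Nat.cast_zero] at h'
      exact degree_eq_bot.1 (Nat.WithBot.lt_zero_iff.1 h')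
    -- Multiplying by `e^(-l i t)` keeps the zeros and makes the `i`-th exponent 0, so
    -- differentiation lowers the degree bound of `p i` and raises no other.
    set m : ι → ℝ := fun a => l a - l i with hm
    have hminj : Function.Injective m := fun a b h => hl (sub_left_injective h)
    set f : ℝ → ℝ := fun t => ∑ a, (p a).eval t * Real.exp (l a * t) with hf
    set g : ℝ → ℝ := fun t => ∑ a, (p a).eval t * Real.exp (m a * t) with hgdef
    set q : ι → ℝ[X] := fun a => derivative (p a) + C (m a) * p a with hq
    have hgf : g = fun t => Real.exp (-l i * t) * f t := by
      funext t
      simp only [hgdef, hf, hm, Finset.mul_sum]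
      refine Finset.sum_congr rfl fun a _ => ?_
      rw [mul_left_comm, ← Real.exp_add]
      ring_nf
    have hfd : Differentiable ℝ f := fun t => (hasDerivAt_expPolynomial p l t).differentiableAt
    have hgd : ∀ t, HasDerivAt g (∑ a, (q a).eval t * Real.exp (m a * t)) t :=
      hasDerivAt_expPolynomial p m
    have hSg : ∀ t ∈ S, g t = 0 := fun t ht => by
      rw [hgf]; simp only; rw [show f t = 0 from hS t ht, mul_zero]
    have hTg : ∀ t ∈ T, deriv g t = 0 := fun t ht => by
      rw [hgf, deriv_fun_mul (by fun_prop) (hfd t), hT t ht,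
        show f t = 0 from hS t (hTS ht), mul_zero, mul_zero, add_zero]
    -- If the derivative vanishes identically, `g` is a nonzero constant and has no zeros.
    by_cases hq0 : q = 0
    · have hpa : ∀ a, a ≠ i → p a = 0 := fun a ha =>
        Polynomial.eq_zero_of_derivative_add_C_mul_eq_zero (sub_ne_zero.2 (hl.ne ha))
          (congrFun hq0 a)
      have hder : derivative (p i) = 0 := by
        have := congrFun hq0 i
        simpa [hq, hm] using this
      have hg0 : ∀ t, g t ≠ 0 := by
        intro t
        have : g t = (p i).eval t := by
          simp only [hgdef]
          rw [Finset.sum_eq_single i]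
          · simp [hm]
          · intro a _ ha
            rw [hpa a ha, eval_zero, zero_mul]
          · simp
        rw [this]
        have hC := derivative_eq_zero.1 hder
        rw [eq_C_of_natDegree_eq_zero hC] at hi ⊢
        rw [eval_C]
        exact fun h => hi (by rw [h, C_0]; rfl)
      have hSe : S = ∅ := Finset.eq_empty_of_forall_notMem fun t ht => hg0 t (hSg t ht)
      subst hSe
      rw [Finset.subset_empty.1 hTS]
      simp
    · obtain ⟨U, hU, hc⟩ := exists_finset_deriv_eq_zero
        (fun t => (hgd t).differentiableAt) hTS hSg hTg
      have hlt := ih (Function.update n i (n i - 1)) q m hminj ?_ hq0 ?_ U ∅ (by simp)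
        (fun t ht => by rw [← (hgd t).deriv]; exact hU t ht) (by simp)
      · simp only [Finset.card_empty] at hlt
        omega
      · intro a
        by_cases ha : a = i
        · subst ha
          rw [Function.update_self]
          have : q a = derivative (p a) := by simp [hq, hm]
          rw [this]
          have h1 := degree_derivative_lt hi
          have h2 := hdeg a
          rw [degree_lt_iff_coeff_zero] at h2 ⊢
          intro k hk
          rw [coeff_derivative, h2 (k + 1) (by omega), zero_mul]
        · rw [Function.update_of_ne ha]
          refine (degree_add_le _ _).trans_lt (max_lt ?_ ?_)
          · exact (degree_derivative_le).trans_lt (hdeg a)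
          · exact (degree_C_mul (sub_ne_zero.2 (hl.ne ha))).trans_lt (hdeg a)
      · rw [← Finset.add_sum_erase _ _ (Finset.mem_univ i)] at hN ⊢
        rw [Function.update_self, Finset.sum_congr rfl fun a ha =>
          Function.update_of_ne (Finset.ne_of_mem_erase ha) _ _]
        omega

/-! ### Sign changes on the half-line -/

/-- `f` does not change sign on the open half-line `(0, ∞)`. -/
def HasConstantSign (f : ℝ → ℝ) : Prop := (∀ x, 0 < x → 0 ≤ f x) ∨ ∀ x, 0 < x → f x ≤ 0

theorem hasConstantSign_of_ne_zero {f : ℝ → ℝ} (hf : ContinuousOn f (Set.Ioi 0))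
    (h : ∀ x, 0 < x → f x ≠ 0) : HasConstantSign f := by
  by_contra hcon
  simp only [HasConstantSign, not_or, not_forall, not_le] at hcon
  obtain ⟨⟨a, ha, hfa⟩, b, hb, hfb⟩ := hcon
  obtain ⟨c, hc, hc0⟩ := isPreconnected_Ioi.intermediate_value (Set.mem_Ioi.2 ha)
    (Set.mem_Ioi.2 hb) hf ⟨hfa.le, hfb.le⟩
  exact h c hc hc0

theorem HasConstantSign.congr {f g : ℝ → ℝ} (hf : HasConstantSign f)
    (h : ∀ x, 0 < x → g x = f x) : HasConstantSign g :=
  hf.imp (fun H x hx => (H x hx).trans_eq (h x hx).symm) fun H x hx => (h x hx).trans_le (H x hx)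

theorem HasConstantSign.mul {f g : ℝ → ℝ} (hf : HasConstantSign f) (hg : HasConstantSign g) :
    HasConstantSign fun x => f x * g x := by
  rcases hf with hf | hf <;> rcases hg with hg | hg
  · exact Or.inl fun x hx => mul_nonneg (hf x hx) (hg x hx)
  · exact Or.inr fun x hx => mul_nonpos_of_nonneg_of_nonpos (hf x hx) (hg x hx)
  · exact Or.inr fun x hx => mul_nonpos_of_nonpos_of_nonneg (hf x hx) (hg x hx)
  · exact Or.inl fun x hx => mul_nonneg_of_nonpos_of_nonpos (hf x hx) (hg x hx)

/-- The positive sign changes of a polynomial can be split off as simple linear factors. -/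
theorem exists_prod_mul_hasConstantSign (N : ℕ) : ∀ Q : ℝ[X], Q ≠ 0 → Q.natDegree = N →
    ∃ (Z : Finset ℝ) (S : ℝ[X]), (∀ z ∈ Z, 0 < z) ∧ Q = (∏ z ∈ Z, (X - C z)) * S ∧
      HasConstantSign fun x => S.eval x := by
  induction N with
  | zero =>
    intro Q hQ hdeg
    refine ⟨∅, Q, by simp, by simp, hasConstantSign_of_ne_zero Q.continuous.continuousOn ?_⟩
    intro x _ h
    rw [eq_C_of_natDegree_eq_zero hdeg] at h hQ
    rw [eval_C] at h
    exact hQ (by rw [h, C_0])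
  | succ N ih =>
    intro Q hQ hdeg
    by_cases hroot : ∃ a, 0 < a ∧ Q.eval a = 0
    · obtain ⟨a, ha, hQa⟩ := hroot
      obtain ⟨Q₁, rfl⟩ := dvd_iff_isRoot.2 hQa
      have hQ₁ : Q₁ ≠ 0 := right_ne_zero_of_mul hQ
      rw [natDegree_mul (X_sub_C_ne_zero a) hQ₁, natDegree_X_sub_C] at hdeg
      obtain ⟨Z, S, hZ, hQS, hS⟩ := ih Q₁ hQ₁ (by omega)
      -- A second factor `X - a` cancels the sign change at `a`; the resulting square goes into `S`.
      by_cases haZ : a ∈ Z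
      · refine ⟨Z.erase a, (X - C a) ^ 2 * S, fun z hz => hZ z (Finset.mem_of_mem_erase hz), ?_, ?_⟩
        · rw [hQS, ← Finset.mul_prod_erase Z _ haZ]
          ring
        · refine (HasConstantSign.mul (f := fun x => (x - a) ^ 2)
            (Or.inl fun x _ => sq_nonneg _) hS).congr fun x _ => ?_
          simp
      · refine ⟨insert a Z, S, ?_, ?_, hS⟩
        · intro z hz
          rcases Finset.mem_insert.1 hz with rfl | hz
          exacts [ha, hZ z hz]
        · rw [hQS, Finset.prod_insert haZ, mul_assoc]
    · push Not at hroot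
      exact ⟨∅, Q, by simp, by simp, hasConstantSign_of_ne_zero Q.continuous.continuousOn hroot⟩

/-- A function whose only zeros in `(0, ∞)` are simple zeros at the points of `Z` changes sign
exactly there. -/
theorem hasConstantSign_mul_prod (Z : Finset ℝ) : ∀ f : ℝ → ℝ, ContinuousOn f (Set.Ioi 0) →
    (∀ z ∈ Z, 0 < z) → (∀ x, 0 < x → f x = 0 → x ∈ Z) → (∀ z ∈ Z, f z = 0) →
    (∀ z ∈ Z, deriv f z ≠ 0) → HasConstantSign fun x => f x * ∏ z ∈ Z, (x - z) := by
  induction Z using Finset.induction_on with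
  | empty =>
    intro f hf _ h _ _
    refine (hasConstantSign_of_ne_zero hf fun x hx h0 => ?_).congr fun x _ => by simp
    simpa using h x hx h0
  | insert a Z haZ ih =>
    intro f hf hpos hzero hval hder
    have ha : 0 < a := hpos a (Finset.mem_insert_self _ _)
    have hfa : f a = 0 := hval a (Finset.mem_insert_self _ _)
    have hda : deriv f a ≠ 0 := hder a (Finset.mem_insert_self _ _)
    have hslope : ∀ x, x ≠ a → dslope f a x = (x - a)⁻¹ * f x := fun x hx => by
      rw [dslope_of_ne f hx, slope_def_field, hfa, sub_zero, div_eq_inv_mul]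
    -- `dslope f a` divides out the simple zero at `a`: its value there is `f'(a) ≠ 0`.
    have key := ih (dslope f a)
      ((continuousOn_dslope (Ioi_mem_nhds ha)).2 ⟨hf, differentiableAt_of_deriv_ne_zero hda⟩)
      (fun z hz => hpos z (Finset.mem_insert_of_mem hz)) ?_ ?_ ?_
    · refine (HasConstantSign.mul (f := fun x => (x - a) ^ 2)
        (Or.inl fun x _ => sq_nonneg _) key).congr fun x _ => ?_
      rw [Finset.prod_insert haZ]
      by_cases hx : x = a
      · subst hx
        simp
      · have : x - a ≠ 0 := sub_ne_zero.2 hx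
        rw [hslope x hx]
        field_simp
    · intro x hx h0
      by_cases hxa : x = a
      · subst hxa
        rw [dslope_same] at h0
        exact absurd h0 hda
      · rw [hslope x hxa] at h0
        have := (mul_eq_zero.1 h0).resolve_left (inv_ne_zero (sub_ne_zero.2 hxa))
        exact (Finset.mem_insert.1 (hzero x hx this)).resolve_left hxa
    · intro z hz
      rw [hslope z (fun h => haZ (h ▸ hz)), hval z (Finset.mem_insert_of_mem hz), mul_zero]
    · intro z hz
      have hza : z ≠ a := fun h => haZ (h ▸ hz)
      have hzI : z ∈ insert a Z := Finset.mem_insert_of_mem hz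
      have hev : dslope f a =ᶠ[nhds z] fun x => (x - a)⁻¹ * f x := by
        filter_upwards [isOpen_ne.mem_nhds hza] with x hx using hslope x hx
      have h1 : DifferentiableAt ℝ (fun x : ℝ => (x - a)⁻¹) z :=
        (differentiableAt_id.sub_const a).inv (sub_ne_zero.2 hza)
      rw [hev.deriv_eq, deriv_fun_mul h1 (differentiableAt_of_deriv_ne_zero (hder z hzI)),
        hval z hzI, mul_zero, zero_add]
      exact mul_ne_zero (inv_ne_zero (sub_ne_zero.2 hza)) (hder z hzI)

/-! ### Chebyshev systems: sign changes, existence and uniqueness -/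

theorem exists_le_sum_eq {ι : Type*} [Fintype ι] [DecidableEq ι] (n : ι → ℕ) (s : ℕ)
    (hs : s ≤ ∑ i, n i) : ∃ m : ι → ℕ, m ≤ n ∧ ∑ i, m i = s := by
  induction s with
  | zero => exact ⟨0, fun i => Nat.zero_le _, by simp⟩
  | succ s ih =>
    obtain ⟨m, hm, hms⟩ := ih (by omega)
    obtain ⟨i, -, hi⟩ := Finset.exists_lt_of_sum_lt (by omega : ∑ i, m i < ∑ i, n i)
    refine ⟨m + Pi.single i 1, fun j => ?_, ?_⟩
    · by_cases hj : j = i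
      · subst hj
        simpa using hi
      · simpa [hj] using hm j
    · simp [Finset.sum_add_distrib, hms]

/-- Weights `w j` on `(0, ∞)` with finite moments such that a nontrivial combination `∑ pⱼ wⱼ`
with `deg pⱼ < nⱼ` has fewer than `∑ nⱼ` positive zeros, even if some double zeros are counted
twice. -/
structure IsChebyshevSystem {r : ℕ} (w : Fin r → ℝ → ℝ) : Prop where
  continuousOn : ∀ j, ContinuousOn (w j) (Set.Ioi 0)
  integrableOn : ∀ j (k : ℕ), IntegrableOn (fun x => x ^ k * w j x) (Set.Ioi 0)
  card_zeros_lt : ∀ (n : Fin r → ℕ) (p : Fin r → ℝ[X]), (∀ j, (p j).degree < n j) → p ≠ 0 →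
    ∀ S T : Finset ℝ, T ⊆ S → (∀ x ∈ S, 0 < x) →
      (∀ x ∈ S, ∑ j, (p j).eval x * w j x = 0) →
      (∀ x ∈ T, deriv (fun x => ∑ j, (p j).eval x * w j x) x = 0) →
      S.card + T.card < ∑ j, n j

/-- The orthogonality conditions of multi-index `n` for the weights `w`. -/
def IsMultipleOrthogonal {r : ℕ} (w : Fin r → ℝ → ℝ) (n : Fin r → ℕ) (Q : ℝ[X]) : Prop :=
  ∀ j : Fin r, ∀ k : ℕ, k < n j → ∫ x in Set.Ioi (0 : ℝ), x ^ k * Q.eval x * w j x = 0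

theorem finrank_pi_degreeLT {ι : Type*} [Fintype ι] (n : ι → ℕ) :
    Module.finrank ℝ (∀ i, degreeLT ℝ (n i)) = ∑ i, n i := by
  rw [Module.finrank_pi_fintype]
  exact Finset.sum_congr rfl fun i _ => by
    rw [(degreeLTEquiv ℝ (n i)).finrank_eq, Module.finrank_fin_fun]

namespace IsChebyshevSystem

variable {r : ℕ} {w : Fin r → ℝ → ℝ}

theorem integrableOn_eval_mul (hw : IsChebyshevSystem w) (P : ℝ[X]) (j : Fin r) :
    IntegrableOn (fun x => P.eval x * w j x) (Set.Ioi 0) := by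
  induction P using Polynomial.induction_on' with
  | add p q hp hq =>
    refine (hp.add hq).congr_fun (fun x _ => ?_) measurableSet_Ioi
    simp [add_mul]
  | monomial k a =>
    refine IntegrableOn.congr_fun ((hw.integrableOn j k).const_mul a) (fun x _ => ?_) measurableSet_Ioi
    simp [mul_assoc]

/-- Integration against a weight as a linear functional on polynomials. -/
noncomputable def moment (hw : IsChebyshevSystem w) (j : Fin r) : ℝ[X] →ₗ[ℝ] ℝ where
  toFun P := ∫ x in Set.Ioi (0 : ℝ), P.eval x * w j x
  map_add' P Q := by
    rw [← integral_add (hw.integrableOn_eval_mul P j) (hw.integrableOn_eval_mul Q j)]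
    simp [add_mul]
  map_smul' a P := by
    rw [RingHom.id_apply, smul_eq_mul, ← integral_const_mul]
    simp [mul_assoc]

theorem moment_apply (hw : IsChebyshevSystem w) (j : Fin r) (P : ℝ[X]) :
    hw.moment j P = ∫ x in Set.Ioi (0 : ℝ), P.eval x * w j x := rfl

theorem isMultipleOrthogonal_iff (hw : IsChebyshevSystem w) {n : Fin r → ℕ} {Q : ℝ[X]} :
    IsMultipleOrthogonal w n Q ↔ ∀ j, ∀ k, k < n j → hw.moment j (X ^ k * Q) = 0 := by
  simp [IsMultipleOrthogonal, moment_apply]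

theorem moment_mul_eq_zero (hw : IsChebyshevSystem w) {n : Fin r → ℕ} {Q : ℝ[X]}
    (hQ : IsMultipleOrthogonal w n Q) (j : Fin r) {p : ℝ[X]} (hp : p.degree < n j) :
    hw.moment j (p * Q) = 0 := by
  rw [hw.isMultipleOrthogonal_iff] at hQ
  by_cases hp0 : p = 0
  · simp [hp0]
  rw [p.as_sum_range_C_mul_X_pow, Finset.sum_mul, map_sum]
  refine Finset.sum_eq_zero fun k hk => ?_
  rw [mul_assoc, ← smul_eq_C_mul, map_smul, hQ j k, smul_zero]
  rw [degree_eq_natDegree hp0, Nat.cast_lt] at hp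
  rw [Finset.mem_range] at hk
  omega

theorem isMultipleOrthogonal_combination (hw : IsChebyshevSystem w) {n : Fin r → ℕ} {P Q : ℝ[X]}
    (hP : IsMultipleOrthogonal w n P) (hQ : IsMultipleOrthogonal w n Q) (a b : ℝ) :
    IsMultipleOrthogonal w n (a • P + b • Q) := by
  rw [hw.isMultipleOrthogonal_iff] at *
  intro j k hk
  rw [mul_add, mul_smul_comm, mul_smul_comm, map_add, map_smul, map_smul, hP j k hk, hQ j k hk]
  simp

/-- A combination of the weights that changes sign exactly at prescribed points. -/
theorem exists_combination (hw : IsChebyshevSystem w) {n : Fin r → ℕ} {Z : Finset ℝ}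
    (hZ : ∀ z ∈ Z, 0 < z) (hcard : Z.card < ∑ j, n j) :
    ∃ p : Fin r → ℝ[X], (∀ j, (p j).degree < n j) ∧
      (∀ x, 0 < x → ∑ j, (p j).eval x * w j x = 0 → x ∈ Z) ∧
      HasConstantSign fun x => (∑ j, (p j).eval x * w j x) * ∏ z ∈ Z, (x - z) := by
  -- With `|m| = #Z + 1` there is one more coefficient than vanishing conditions, while the
  -- Chebyshev bound leaves room for no further zero and no double zero.
  obtain ⟨m, hmn, hm⟩ := exists_le_sum_eq n (Z.card + 1) hcard
  let φ : (∀ j, degreeLT ℝ (m j)) →ₗ[ℝ] (Z → ℝ) :=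
    LinearMap.pi fun z => ∑ j, (w j z) • ((leval (z : ℝ)) ∘ₗ (degreeLT ℝ (m j)).subtype ∘ₗ
      LinearMap.proj j)
  have hφ : ∀ q z, φ q z = ∑ j, (q j : ℝ[X]).eval (z : ℝ) * w j z := by
    intro q z
    simp [φ, leval, mul_comm]
  have hker : LinearMap.ker φ ≠ ⊥ := by
    apply LinearMap.ker_ne_bot_of_finrank_lt
    rw [finrank_pi_degreeLT, hm]
    simp
  obtain ⟨q, hqk, hq0⟩ := (Submodule.ne_bot_iff _).1 hker
  have hdeg : ∀ j, (q j : ℝ[X]).degree < m j := fun j => mem_degreeLT.1 (q j).2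
  have hp0 : (fun j => (q j : ℝ[X])) ≠ 0 := fun h => hq0 (funext fun j => Subtype.ext (congrFun h j))
  have hval : ∀ z ∈ Z, ∑ j, (q j : ℝ[X]).eval z * w j z = 0 := by
    intro z hz
    rw [← hφ q ⟨z, hz⟩, LinearMap.mem_ker.1 hqk]
    rfl
  have hzero : ∀ x, 0 < x → ∑ j, (q j : ℝ[X]).eval x * w j x = 0 → x ∈ Z := by
    intro x hx hx0
    by_contra hxZ
    have := hw.card_zeros_lt m _ hdeg hp0 (insert x Z) ∅ (by simp) ?_ ?_ (by simp)
    · rw [Finset.card_insert_of_notMem hxZ, hm] at this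
      simp at this
    · intro y hy
      rcases Finset.mem_insert.1 hy with rfl | hy
      exacts [hx, hZ y hy]
    · intro y hy
      rcases Finset.mem_insert.1 hy with rfl | hy
      exacts [hx0, hval y hy]
  refine ⟨fun j => q j, fun j => (hdeg j).trans_le (Nat.cast_le.2 (hmn j)), hzero,
    hasConstantSign_mul_prod Z _ ?_ hZ hzero hval ?_⟩
  · exact continuousOn_finsetSum _ fun j _ =>
      (Polynomial.continuous _).continuousOn.mul (hw.continuousOn j)
  · intro z hz hd
    have := hw.card_zeros_lt m _ hdeg hp0 Z {z} (by simpa using hz) hZ hval (by simpa using hd)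
    rw [hm] at this
    simp at this

/-- A nonzero multiple orthogonal function changes sign at least `∑ nⱼ` times. -/
theorem le_card_of_isMultipleOrthogonal (hw : IsChebyshevSystem w) {n : Fin r → ℕ}
    {Z : Finset ℝ} {S : ℝ[X]} (hZ : ∀ z ∈ Z, 0 < z) (hS0 : S ≠ 0)
    (hS : HasConstantSign fun x => S.eval x)
    (hQ : IsMultipleOrthogonal w n ((∏ z ∈ Z, (X - C z)) * S)) : ∑ j, n j ≤ Z.card := by
  by_contra! hlt
  obtain ⟨p, hdeg, hzero, hsign⟩ := hw.exists_combination hZ hlt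
  set Q := (∏ z ∈ Z, (X - C z)) * S with hQdef
  have hQ0 : Q ≠ 0 := mul_ne_zero (Finset.prod_ne_zero_iff.2 fun z _ => X_sub_C_ne_zero z) hS0
  set F : ℝ → ℝ := fun x => Q.eval x * ∑ j, (p j).eval x * w j x with hF
  have hFs : HasConstantSign F := (hS.mul hsign).congr fun x _ => by
    simp only [hF, hQdef, eval_mul, eval_prod, eval_sub, eval_X, eval_C]
    ring
  have hFsum : ∀ x, F x = ∑ j, (p j * Q).eval x * w j x := fun x => by
    simp only [hF, Finset.mul_sum, eval_mul]
    exact Finset.sum_congr rfl fun j _ => by ring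
  have hint : IntegrableOn F (Set.Ioi 0) := by
    rw [show F = _ from funext hFsum]
    exact integrable_finsetSum _ fun j _ => hw.integrableOn_eval_mul _ j
  have hI : ∫ x in Set.Ioi (0 : ℝ), F x = 0 := by
    simp only [hFsum]
    rw [integral_finsetSum _ fun j _ => hw.integrableOn_eval_mul _ j]
    exact Finset.sum_eq_zero fun j _ => hw.moment_mul_eq_zero hQ j (hdeg j)
  have hae : F =ᵐ[volume.restrict (Set.Ioi 0)] 0 := by
    rcases hFs with h | h
    · exact (setIntegral_eq_zero_iff_of_nonneg_ae
        ((ae_restrict_mem measurableSet_Ioi).mono fun x hx => h x hx) hint).1 hI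
    · have := (setIntegral_eq_zero_iff_of_nonneg_ae (f := fun x => -F x)
        ((ae_restrict_mem measurableSet_Ioi).mono fun x hx => neg_nonneg.2 (h x hx)) hint.neg).1
        (by rw [integral_neg, hI, neg_zero])
      exact this.mono fun x hx => neg_eq_zero.1 hx
  -- `F` has constant sign and integral 0, so it vanishes almost everywhere, yet it has only
  -- finitely many positive zeros.
  have hfin : Set.Ioi (0 : ℝ) ∩ {x | F x = 0} ⊆ ((Q.roots.toFinset ∪ Z : Finset ℝ) : Set ℝ) := by
    rintro x ⟨hx, hx0⟩
    rw [Finset.coe_union, Set.mem_union]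
    rcases mul_eq_zero.1 hx0 with h | h
    · left
      simpa [hQ0] using h
    · exact Or.inr (hzero x hx h)
  have h0 : volume (Set.Ioi (0 : ℝ)) = 0 := by
    rw [Filter.EventuallyEq, ae_restrict_iff' measurableSet_Ioi, ae_iff] at hae
    refine measure_mono_null (t := {a | ¬(a ∈ Set.Ioi (0 : ℝ) → F a = (0 : ℝ → ℝ) a)} ∪
      ((Q.roots.toFinset ∪ Z : Finset ℝ) : Set ℝ)) ?_
      (measure_union_null hae (Finset.measure_zero _ _))
    intro x hx
    by_cases h : F x = 0
    · exact Or.inr (hfin ⟨hx, h⟩)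
    · exact Or.inl fun h' => h (h' hx)
  simp at h0

theorem sum_le_natDegree (hw : IsChebyshevSystem w) {n : Fin r → ℕ} {Q : ℝ[X]} (hQ0 : Q ≠ 0)
    (hQ : IsMultipleOrthogonal w n Q) : ∑ j, n j ≤ Q.natDegree := by
  obtain ⟨Z, S, hZ, rfl, hS⟩ := exists_prod_mul_hasConstantSign _ Q hQ0 rfl
  rw [natDegree_mul (left_ne_zero_of_mul hQ0) (right_ne_zero_of_mul hQ0),
    natDegree_prod _ _ fun z _ => X_sub_C_ne_zero z]
  simp only [natDegree_X_sub_C, Finset.sum_const, smul_eq_mul, mul_one]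
  exact (hw.le_card_of_isMultipleOrthogonal hZ (right_ne_zero_of_mul hQ0) hS hQ).trans
    (Nat.le_add_right _ _)

/-- The leading terms cancel in the difference, leaving an orthogonal polynomial of degree below
`|n|`. -/
theorem isTypeIIOrthogonal_unique (hw : IsChebyshevSystem w) {n : Fin r → ℕ} {P R : ℝ[X]}
    (hP : IsTypeIIOrthogonal w n P) (hR : IsTypeIIOrthogonal w n R) : P = R := by
  obtain ⟨hPm, hPd, hPo⟩ := hP
  obtain ⟨hRm, hRd, hRo⟩ := hR
  by_contra hne
  have ho := hw.isMultipleOrthogonal_combination hPo hRo 1 (-1)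
  rw [one_smul, neg_smul, one_smul, ← sub_eq_add_neg] at ho
  have h0 : P - R ≠ 0 := sub_ne_zero.2 hne
  have hlt : (P - R).degree < P.degree := degree_sub_lt_left
    (by rw [degree_eq_natDegree hPm.ne_zero, degree_eq_natDegree hRm.ne_zero, hPd, hRd])
    hPm.ne_zero (by rw [hPm.leadingCoeff, hRm.leadingCoeff])
  have := hw.sum_le_natDegree h0 ho
  have hlt := natDegree_lt_natDegree h0 hlt
  omega

/-- There are `|n| + 1` coefficients for `|n|` linear conditions; a nonzero solution has degree
exactly `|n|` by `sum_le_natDegree` and can be made monic. -/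
theorem exists_isTypeIIOrthogonal (hw : IsChebyshevSystem w) (n : Fin r → ℕ) :
    ∃ P : ℝ[X], IsTypeIIOrthogonal w n P := by
  set N := ∑ j, n j with hN
  let φ : degreeLT ℝ (N + 1) →ₗ[ℝ] ((Σ j, Fin (n j)) → ℝ) :=
    LinearMap.pi fun i => hw.moment i.1 ∘ₗ LinearMap.mulLeft ℝ (X ^ (i.2 : ℕ)) ∘ₗ
      (degreeLT ℝ (N + 1)).subtype
  have hker : LinearMap.ker φ ≠ ⊥ := by
    apply LinearMap.ker_ne_bot_of_finrank_lt
    rw [(degreeLTEquiv ℝ (N + 1)).finrank_eq, Module.finrank_fin_fun, Module.finrank_fintype_fun_eq_card]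
    simp [hN]
  obtain ⟨⟨q, hqd⟩, hqk, hq0⟩ := (Submodule.ne_bot_iff _).1 hker
  have hq0 : q ≠ 0 := fun h => hq0 (Subtype.ext h)
  have hqo : IsMultipleOrthogonal w n q := hw.isMultipleOrthogonal_iff.2 fun j k hk =>
    congrFun (LinearMap.mem_ker.1 hqk) ⟨j, ⟨k, hk⟩⟩
  have hdeg : q.natDegree = N := by
    refine le_antisymm ?_ (hw.sum_le_natDegree hq0 hqo)
    rw [mem_degreeLT, degree_eq_natDegree hq0, Nat.cast_lt] at hqd
    omega
  have hlc : q.leadingCoeff ≠ 0 := leadingCoeff_ne_zero.2 hq0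
  -- The zero summand only gives the form `a • P + b • Q` required by
  -- `isMultipleOrthogonal_combination`.
  refine ⟨q.leadingCoeff⁻¹ • q + (0 : ℝ) • q, ?_, ?_, ?_⟩
  · rw [zero_smul, add_zero, Monic, leadingCoeff_smul_of_smul_regular _
      (IsSMulRegular.of_ne_zero (inv_ne_zero hlc)), smul_eq_mul, inv_mul_cancel₀ hlc]
  · rw [zero_smul, add_zero, natDegree_smul _ (inv_ne_zero hlc), hdeg]
  · exact hw.isMultipleOrthogonal_combination hqo hqo _ _

theorem existsUnique_isTypeIIOrthogonal (hw : IsChebyshevSystem w) (n : Fin r → ℕ) :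
    ∃! P : ℝ[X], IsTypeIIOrthogonal w n P := by
  obtain ⟨P, hP⟩ := hw.exists_isTypeIIOrthogonal n
  exact ⟨P, hP, fun R hR => hw.isTypeIIOrthogonal_unique hR hP⟩

theorem isTypeIIOrthogonal_epsilon (hw : IsChebyshevSystem w) (n : Fin r → ℕ) :
    IsTypeIIOrthogonal w n (Classical.epsilon (IsTypeIIOrthogonal w n)) :=
  Classical.epsilon_spec (hw.exists_isTypeIIOrthogonal n)

end IsChebyshevSystem

/-! ### Positivity of the Wronskian -/

theorem Polynomial.eval_pos_of_forall_ne_zero {P : ℝ[X]} (hlead : 0 < P.leadingCoeff)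
    (h : ∀ x, 0 < x → P.eval x ≠ 0) {x : ℝ} (hx : 0 < x) : 0 < P.eval x := by
  by_cases hd : 0 < P.degree
  · obtain ⟨y, hy0, hy⟩ := ((Filter.eventually_gt_atTop (0 : ℝ)).and
      ((P.tendsto_atTop_of_leadingCoeff_nonneg hd hlead.le).eventually_gt_atTop 0)).exists
    rcases hasConstantSign_of_ne_zero P.continuous.continuousOn h with hs | hs
    · exact (hs x hx).lt_of_ne (h x hx).symm
    · exact absurd (hs y hy0) (not_le.2 hy)
  · have hC := natDegree_eq_zero_iff_degree_le_zero.2 (not_lt.1 hd)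
    have h1 : P.eval x = P.leadingCoeff := by
      rw [leadingCoeff, hC]
      conv_lhs => rw [eq_C_of_natDegree_eq_zero hC, eval_C]
    rwa [h1]

/-- With `N = deg A`, the coefficient of degree `2 N` is `(N + 1) - N`. The case `N = 0` is separate
because of the natural subtraction `N - 1`. -/
theorem Polynomial.leadingCoeff_wronskian {A B : ℝ[X]} (hA : A.Monic) (hB : B.Monic)
    (hdeg : B.natDegree = A.natDegree + 1) : (wronskian A B).leadingCoeff = 1 := by
  set N := A.natDegree with hN
  have hA1 : A.coeff N = 1 := hA.coeff_natDegree
  have hB1 : B.coeff (N + 1) = 1 := by rw [← hdeg]; exact hB.coeff_natDegree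
  have hA'd : (derivative A).natDegree ≤ N - 1 := natDegree_derivative_le A
  have hB'd : (derivative B).natDegree ≤ N := (natDegree_derivative_le B).trans (by omega)
  have h1 : (A * derivative B).coeff (N + N) = N + 1 := by
    rw [coeff_mul_add_eq_of_natDegree_le le_rfl hB'd, coeff_derivative, hA1, hB1]
    ring
  have h2 : (derivative A * B).coeff (N + N) = N := by
    rcases Nat.eq_zero_or_pos N with h0 | h0
    · have : derivative A = 0 := derivative_of_natDegree_zero (hN.symm.trans h0)
      simp [this, h0]
    · rw [show N + N = (N - 1) + (N + 1) by omega, coeff_mul_add_eq_of_natDegree_le hA'd hdeg.le,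
        coeff_derivative, hB1, Nat.sub_add_cancel h0, hA1, Nat.cast_sub h0]
      simp
  have hc : (wronskian A B).coeff (N + N) = 1 := by
    rw [wronskian, coeff_sub, h1, h2]
    ring
  have hle : (wronskian A B).natDegree ≤ N + N := by
    refine (natDegree_sub_le _ _).trans (max_le ?_ ?_)
    · exact natDegree_mul_le.trans (by omega)
    · rcases Nat.eq_zero_or_pos N with h0 | h0
      · have : derivative A = 0 := derivative_of_natDegree_zero (hN.symm.trans h0)
        simp [this]
      · exact natDegree_mul_le.trans (by omega)
  rw [leadingCoeff, natDegree_eq_of_le_of_coeff_ne_zero hle (by rw [hc]; exact one_ne_zero), hc]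

theorem sum_add_unitIndex {r : ℕ} (n : Fin r → ℕ) (k : Fin r) :
    ∑ j, (n + unitIndex k) j = ∑ j, n j + 1 := by
  simp [unitIndex, Finset.sum_add_distrib]

namespace IsChebyshevSystem

variable {r : ℕ} {w : Fin r → ℝ → ℝ}

/-- A multiple orthogonal function of degree at most `∑ nⱼ + 1` has only simple positive zeros. -/
theorem eq_zero_of_double_zero (hw : IsChebyshevSystem w) {n : Fin r → ℕ} {Q : ℝ[X]}
    (hQ : IsMultipleOrthogonal w n Q) (hdeg : Q.natDegree ≤ ∑ j, n j + 1) {x : ℝ} (hx : 0 < x)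
    (h0 : Q.eval x = 0) (h1 : (derivative Q).eval x = 0) : Q = 0 := by
  by_contra hQ0
  obtain ⟨Z, S, hZ, hQS, hS⟩ := exists_prod_mul_hasConstantSign _ Q hQ0 rfl
  set R := ∏ z ∈ Z, (X - C z) with hR
  rw [hQS] at hQ hQ0 h0 h1 hdeg
  have hS0 := right_ne_zero_of_mul hQ0
  have hcard := hw.le_card_of_isMultipleOrthogonal hZ hS0 hS hQ
  rw [natDegree_mul (left_ne_zero_of_mul hQ0) hS0, hR,
    natDegree_prod _ _ fun z _ => X_sub_C_ne_zero z] at hdeg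
  simp only [natDegree_X_sub_C, Finset.sum_const, smul_eq_mul, mul_one] at hdeg
  have hSd : S.natDegree ≤ 1 := by omega
  rw [derivative_mul, eval_add, eval_mul, eval_mul] at h1
  rw [eval_mul] at h0
  have hSform := eq_X_add_C_of_natDegree_le_one hSd
  set a := S.coeff 1
  set b := S.coeff 0
  have hSe : ∀ y, S.eval y = a * y + b := fun y => by rw [hSform]; simp
  have hSd' : (derivative S).eval x = a := by rw [hSform]; simp
  -- If `R` vanishes at `x`, its zero is simple, so the double zero of `R * S` still forces `S` to
  -- vanish. But `S` is nonzero of degree at most 1, and a linear `S` would change sign between `x /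
  -- 2` and `2 x`.
  have hSx : S.eval x = 0 := by
    by_cases hRx : R.eval x = 0
    · have hsep : R.Separable := by
        rw [hR]
        exact separable_prod_X_sub_C_iff'.2 fun _ _ _ _ h => h
      have hR' := hsep.eval₂_derivative_ne_zero (RingHom.id ℝ) hRx
      rw [hRx, zero_mul, add_zero] at h1
      exact (mul_eq_zero.1 h1).resolve_left hR'
    · exact (mul_eq_zero.1 h0).resolve_left hRx
  have ha : a ≠ 0 := by
    intro ha
    have hb : b = 0 := by
      have := hSe x
      rw [hSx, ha] at this
      linarith
    exact hS0 (by rw [hSform, ha, hb]; simp)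
  have hSl : ∀ y, S.eval y = a * (y - x) := fun y => by
    have := hSe x
    rw [hSx] at this
    rw [hSe]
    linarith
  have e1 : S.eval (2 * x) = a * x := by rw [hSl]; ring
  have e2 : S.eval (x / 2) = -(a * x) / 2 := by rw [hSl]; ring
  have hax : a * x ≠ 0 := mul_ne_zero ha hx.ne'
  rcases hS with hS | hS
  · have h3 := hS (2 * x) (by positivity)
    have h4 := hS (x / 2) (by positivity)
    simp only [e1, e2] at h3 h4
    exact hax (by linarith)
  · have h3 := hS (2 * x) (by positivity)
    have h4 := hS (x / 2) (by positivity)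
    simp only [e1, e2] at h3 h4
    exact hax (by linarith)

/-- Neighbouring type II multiple orthogonal polynomials have positive Wronskian on `(0, ∞)`. -/
theorem eval_wronskian_pos (hw : IsChebyshevSystem w) {n : Fin r → ℕ} {k : Fin r} {A B : ℝ[X]}
    (hA : IsTypeIIOrthogonal w n A) (hB : IsTypeIIOrthogonal w (n + unitIndex k) B)
    {x : ℝ} (hx : 0 < x) : 0 < (wronskian A B).eval x := by
  obtain ⟨hAm, hAd, hAo⟩ := hA
  obtain ⟨hBm, hBd, hBo⟩ := hB
  rw [sum_add_unitIndex] at hBd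
  have hBo' : IsMultipleOrthogonal w n B := fun j i hi =>
    hBo j i (hi.trans_le (Nat.le_add_right _ _))
  refine eval_pos_of_forall_ne_zero ?_ (fun y hy hW => ?_) hx
  · rw [leadingCoeff_wronskian hAm hBm (by rw [hBd, hAd])]
    exact one_pos
  -- A kernel vector of the Wronskian matrix gives a combination vanishing to second order at `y`.
  · obtain ⟨v, hv, hMv⟩ := Matrix.exists_mulVec_eq_zero_iff.2
      (show (!![A.eval y, B.eval y; (derivative A).eval y, (derivative B).eval y]).det = 0 by
        rw [Matrix.det_fin_two_of, ← hW, wronskian, eval_sub, eval_mul, eval_mul]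
        ring)
    have r0 := congrFun hMv 0
    have r1 := congrFun hMv 1
    simp only [Matrix.mulVec, dotProduct, Fin.sum_univ_two, Matrix.of_apply, Matrix.cons_val_zero,
      Matrix.cons_val_one, Matrix.cons_val', Matrix.cons_val_fin_one, Pi.zero_apply] at r0 r1
    have hQ := hw.eq_zero_of_double_zero
      (hw.isMultipleOrthogonal_combination hAo hBo' (v 0) (v 1)) ?_ hy
      (by simp only [eval_add, eval_smul, smul_eq_mul]; linarith)
      (by simp only [derivative_add, derivative_smul, eval_add, eval_smul, smul_eq_mul]; linarith)
    · have hA0 : B.coeff (∑ j, n j + 1) = 1 := by rw [← hBd]; exact hBm.coeff_natDegree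
      have hA1 : A.coeff (∑ j, n j + 1) = 0 := coeff_eq_zero_of_natDegree_lt (by omega)
      have hv1 : v 1 = 0 := by
        have := congrArg (fun P => coeff P (∑ j, n j + 1)) hQ
        simpa [hA0, hA1] using this
      have hv0 : v 0 = 0 := by
        rw [hv1, zero_smul, add_zero] at hQ
        exact (smul_eq_zero.1 hQ).resolve_right hAm.ne_zero
      apply hv
      funext i
      fin_cases i
      exacts [hv0, hv1]
    · refine (natDegree_add_le _ _).trans (max_le ?_ ?_)
      · exact (natDegree_smul_le _ _).trans (by omega)
      · exact (natDegree_smul_le _ _).trans (by omega)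

end IsChebyshevSystem

/-! ### The Laguerre weights form Chebyshev systems -/

theorem integrableOn_pow_mul_rpow_mul_exp {β c : ℝ} (hβ : -1 < β) (hc : 0 < c) (k : ℕ) :
    IntegrableOn (fun x : ℝ => x ^ k * (x ^ β * Real.exp (-(c * x)))) (Set.Ioi 0) := by
  have hk : -1 < (k : ℝ) + β := by
    have : (0 : ℝ) ≤ k := k.cast_nonneg
    linarith
  refine (integrableOn_rpow_mul_exp_neg_mul_rpow hk one_pos hc).congr_fun (fun x hx => ?_)
    measurableSet_Ioi
  simp only [Real.rpow_one]
  rw [Real.rpow_add hx, Real.rpow_natCast, neg_mul, mul_assoc]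

theorem continuousOn_rpow_mul_exp (β c : ℝ) :
    ContinuousOn (fun x : ℝ => x ^ β * Real.exp (-(c * x))) (Set.Ioi 0) := by
  refine ContinuousOn.mul (fun x hx => ?_) (by fun_prop)
  exact (Real.continuousAt_rpow_const x β (Or.inl (ne_of_gt hx))).continuousWithinAt

/-- Under `x = e^t` each monomial `x^(α_j + k)` becomes a pure exponential. There are `∑ n j` of
them, with distinct exponents because no `α i - α j` is an integer. -/
theorem isChebyshevSystem_laguerreWeightFirst {r : ℕ} {α : Fin r → ℝ} (hα : ∀ i, -1 < α i)
    (hne : ∀ i j, i ≠ j → ∀ m : ℤ, α i - α j ≠ (m : ℝ)) :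
    IsChebyshevSystem (laguerreWeightFirst α) where
  continuousOn j := by
    exact (continuousOn_rpow_mul_exp (α j) 1).congr fun x _ => by simp [laguerreWeightFirst]
  integrableOn j k := by
    simpa [laguerreWeightFirst] using integrableOn_pow_mul_rpow_mul_exp (hα j) one_pos k
  card_zeros_lt n p hdeg hp S T hTS hpos hS hT := by
    let q : (Σ j, Fin (n j)) → ℝ[X] := fun i => C ((p i.1).coeff i.2)
    let l : (Σ j, Fin (n j)) → ℝ := fun i => α i.1 + (i.2 : ℕ)
    have hl : Function.Injective l := by
      rintro ⟨i, a⟩ ⟨j, b⟩ h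
      have h : α i + (a : ℕ) = α j + (b : ℕ) := h
      by_cases hij : i = j
      · subst hij
        have : (a : ℕ) = b := by exact_mod_cast add_left_cancel h
        rw [Fin.ext this]
      · refine absurd ?_ (hne i j hij ((b : ℕ) - (a : ℕ)))
        push_cast
        linarith
    have hq : q ≠ 0 := by
      intro h
      apply hp
      funext j
      ext k
      rw [Pi.zero_apply, coeff_zero]
      by_cases hk : k < n j
      · exact C_eq_zero.1 (congrFun h ⟨j, ⟨k, hk⟩⟩)
      · exact coeff_eq_zero_of_degree_lt ((hdeg j).trans_le (Nat.cast_le.2 (not_lt.1 hk)))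
    set F : ℝ → ℝ := fun t => ∑ i, (q i).eval t * Real.exp (l i * t) with hF
    set f : ℝ → ℝ := fun x => ∑ j, (p j).eval x * laguerreWeightFirst α j x with hf
    have hfF : ∀ x, 0 < x → f x = Real.exp (-x) * F (Real.log x) := by
      intro x hx
      simp only [hf, hF, Fintype.sum_sigma, Finset.mul_sum]
      refine Finset.sum_congr rfl fun j _ => ?_
      rw [eval_eq_sum, ← sum_fin _ (by simp) (hdeg j), Finset.sum_mul]
      refine Finset.sum_congr rfl fun k _ => ?_
      simp only [q, l, eval_C, laguerreWeightFirst]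
      rw [mul_comm (α j + _), ← Real.rpow_def_of_pos hx, Real.rpow_add hx, Real.rpow_natCast]
      ring
    have hinj : Set.InjOn Real.log (S : Set ℝ) :=
      Real.log_injOn_pos.mono fun x hx => hpos x hx
    have hSF : ∀ x ∈ S, F (Real.log x) = 0 := fun x hx =>
      (mul_eq_zero.1 ((hfF x (hpos x hx)).symm.trans (hS x hx))).resolve_left (Real.exp_ne_zero _)
    have hTF : ∀ x ∈ T, deriv F (Real.log x) = 0 := by
      intro x hx
      have hx0 := hpos x (hTS hx)
      have h1 := (hasDerivAt_expPolynomial q l (Real.log x)).differentiableAt.hasDerivAt.comp x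
        (Real.hasDerivAt_log hx0.ne')
      have h2 := (hasDerivAt_id x).neg.exp.mul h1
      have h3 : f =ᶠ[nhds x] fun x => Real.exp (-x) * F (Real.log x) := by
        filter_upwards [Ioi_mem_nhds hx0] with y hy using hfF y hy
      have h4 := (h2.congr_of_eventuallyEq h3).deriv.symm.trans (hT x hx)
      have h5 : F (Real.log x) = 0 := hSF x (hTS hx)
      change _ * F (Real.log x) + Real.exp (-x) * (deriv F (Real.log x) * x⁻¹) = 0 at h4
      rw [h5, mul_zero, zero_add] at h4
      exact (mul_eq_zero.1 ((mul_eq_zero.1 h4).resolve_left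
        (Real.exp_ne_zero _))).resolve_right (inv_ne_zero hx0.ne')
    have key := card_zeros_expPolynomial_lt (∑ j, n j) (fun _ => 1) q l hl
      (fun i => degree_C_le.trans_lt (by norm_num)) hq (by simp)
      (S.image Real.log) (T.image Real.log) (Finset.image_subset_image hTS)
      (by simpa using hSF) (by simpa using hTF)
    rwa [Finset.card_image_of_injOn hinj,
      Finset.card_image_of_injOn (hinj.mono (Finset.coe_subset.2 hTS))] at key

/-- After division by `x^α > 0` the combination is an exponential polynomial with exponents `-c j`.
-/
theorem isChebyshevSystem_laguerreWeightSecond {r : ℕ} {α : ℝ} {c : Fin r → ℝ} (hα : -1 < α)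
    (hc : ∀ i, 0 < c i) (hne : ∀ i j, i ≠ j → c i ≠ c j) :
    IsChebyshevSystem (laguerreWeightSecond α c) where
  continuousOn j := continuousOn_rpow_mul_exp α (c j)
  integrableOn j k := integrableOn_pow_mul_rpow_mul_exp hα (hc j) k
  card_zeros_lt n p hdeg hp S T hTS hpos hS hT := by
    have hl : Function.Injective fun j => -c j := fun i j h => by
      by_contra hij
      exact hne i j hij (neg_injective h)
    set F : ℝ → ℝ := fun t => ∑ i, (p i).eval t * Real.exp (-c i * t) with hF
    have hfF : (fun x => ∑ j, (p j).eval x * laguerreWeightSecond α c j x) =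
        fun x => x ^ α * F x := by
      funext x
      simp only [hF, Finset.mul_sum, laguerreWeightSecond]
      exact Finset.sum_congr rfl fun j _ => by rw [neg_mul]; ring
    have hrpow : ∀ x : ℝ, 0 < x → x ^ α ≠ 0 := fun x hx => (Real.rpow_pos_of_pos hx α).ne'
    have hSF : ∀ x ∈ S, F x = 0 := fun x hx =>
      (mul_eq_zero.1 ((congrFun hfF x).symm.trans (hS x hx))).resolve_left (hrpow x (hpos x hx))
    refine card_zeros_expPolynomial_lt (∑ j, n j) n p _ hl hdeg hp rfl S T hTS hSF fun x hx => ?_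
    have hx0 := hpos x (hTS hx)
    have h := hT x hx
    rw [hfF, deriv_fun_mul (Real.differentiableAt_rpow_const_of_ne α hx0.ne')
      (hasDerivAt_expPolynomial p _ x).differentiableAt, show ∑ i, _ = _ from hSF x (hTS hx),
      mul_zero, zero_add] at h
    exact (mul_eq_zero.1 h).resolve_left (hrpow x hx0)

/-! ### Raising operators -/

/-- Integration by parts against `x ^ β e ^ (-c x)` on the half-line. -/
theorem integral_gammaWeight_by_parts {β c : ℝ} (hβ : -1 < β) (hc : 0 < c) (P : ℝ[X]) :
    ∫ x in Set.Ioi (0 : ℝ), (X * derivative P + C (β + 1) * P - C c * X * P).eval x *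
      (x ^ β * Real.exp (-(c * x))) = 0 := by
  have hβ1 : 0 < β + 1 := by linarith
  have hint : ∀ Q : ℝ[X], IntegrableOn
      (fun x => Q.eval x * (x ^ β * Real.exp (-(c * x)))) (Set.Ioi 0) := by
    intro Q
    induction Q using Polynomial.induction_on' with
    | add p q hp hq =>
      refine (hp.add hq).congr_fun (fun x _ => ?_) measurableSet_Ioi
      simp [add_mul]
    | monomial k a =>
      refine IntegrableOn.congr_fun ((integrableOn_pow_mul_rpow_mul_exp hβ hc k).const_mul a)
        (fun x _ => ?_) measurableSet_Ioi
      simp [mul_assoc]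
  have hlim : ∀ Q : ℝ[X], Filter.Tendsto
      (fun x => Q.eval x * (x ^ (β + 1) * Real.exp (-(c * x)))) Filter.atTop (nhds 0) := by
    intro Q
    induction Q using Polynomial.induction_on' with
    | add p q hp hq => simpa [add_mul] using hp.add hq
    | monomial k a =>
      have h := (tendsto_rpow_mul_exp_neg_mul_atTop_nhds_zero (k + (β + 1)) c hc).const_mul a
      rw [mul_zero] at h
      refine h.congr' ?_
      filter_upwards [Filter.eventually_gt_atTop 0] with x hx
      rw [Real.rpow_add hx, Real.rpow_natCast, eval_monomial, neg_mul]
      ring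
  have key := integral_Ioi_of_hasDerivAt_of_tendsto (a := 0)
    (f := fun x => P.eval x * (x ^ (β + 1) * Real.exp (-(c * x))))
    (f' := fun x => (X * derivative P + C (β + 1) * P - C c * X * P).eval x *
      (x ^ β * Real.exp (-(c * x)))) ?_ ?_ (hint _) (hlim P)
  · rw [key, Real.zero_rpow hβ1.ne']
    simp
  · refine ContinuousAt.continuousWithinAt ?_
    exact P.continuous.continuousAt.mul
      ((Real.continuousAt_rpow_const 0 _ (Or.inr hβ1.le)).mul (by fun_prop))
  · intro x hx
    have hx : 0 < x := hx
    have h1 : HasDerivAt (fun x : ℝ => x ^ (β + 1)) ((β + 1) * x ^ β) x := by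
      simpa using Real.hasDerivAt_rpow_const (p := β + 1) (Or.inl hx.ne')
    have h2 : HasDerivAt (fun x : ℝ => Real.exp (-(c * x)))
        (Real.exp (-(c * x)) * -(c * 1)) x := ((hasDerivAt_id x).const_mul c).neg.exp
    refine ((P.hasDerivAt x).mul (h1.mul h2)).congr_deriv ?_
    simp only [Pi.mul_apply, eval_add, eval_sub, eval_mul, eval_X, eval_C, Real.rpow_add_one hx.ne']
    ring

/-- The raising operator `L ↦ (X - a) L - b X L'`. -/
noncomputable def raise (a b : ℝ) (L : ℝ[X]) : ℝ[X] := (X - C a) * L - C b * (X * derivative L)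

theorem monic_raise {L : ℝ[X]} (hL : L.Monic) (a b : ℝ) :
    (raise a b L).Monic ∧
      (raise a b L).natDegree = L.natDegree + 1 := by
  have hm : ((X - C a) * L).Monic := (monic_X_sub_C a).mul hL
  have hd : ((X - C a) * L).natDegree = L.natDegree + 1 := by
    rw [(monic_X_sub_C a).natDegree_mul hL, natDegree_X_sub_C, add_comm]
  have hlt : (C b * (X * derivative L)).degree < ((X - C a) * L).degree := by
    rw [degree_eq_natDegree hm.ne_zero, hd]
    by_cases hL0 : L.natDegree = 0
    · rw [derivative_of_natDegree_zero hL0]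
      simp only [mul_zero, degree_zero]
      exact WithBot.bot_lt_coe _
    · refine degree_le_natDegree.trans_lt (Nat.cast_lt.2 ?_)
      have h1 := natDegree_derivative_lt hL0
      have h2 := natDegree_C_mul_le b (X * derivative L)
      have h3 := natDegree_mul_le (p := X) (q := derivative L)
      rw [natDegree_X] at h3
      omega
  refine ⟨hm.sub_of_left hlt, ?_⟩
  rw [raise, natDegree_eq_of_degree_eq (degree_sub_eq_left_of_degree_lt hlt), hd]

theorem X_mul_derivative_X_pow_mul (k : ℕ) (L : ℝ[X]) :
    X * derivative (X ^ k * L) = C (k : ℝ) * (X ^ k * L) + X ^ k * (X * derivative L) := by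
  rw [derivative_mul, derivative_X_pow]
  cases k with
  | zero => simp
  | succ k =>
    rw [Nat.add_sub_cancel, pow_succ]
    ring

/-- Modulo an exact derivative, `X^k` times the raised polynomial is a multiple of `X^k L`. -/
theorem isTypeIIOrthogonal_raise_first {r : ℕ} {α : Fin r → ℝ} (hα : ∀ i, 0 < α i) {j : Fin r}
    (hw' : IsChebyshevSystem (laguerreWeightFirst (α - unitVector j))) {n : Fin r → ℕ} {L : ℝ[X]}
    (hL : IsTypeIIOrthogonal (laguerreWeightFirst α) n L) :
    IsTypeIIOrthogonal (laguerreWeightFirst (α - unitVector j)) (n + unitIndex j)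
      (raise (α j) 1 L) := by
  obtain ⟨hm, hd, ho⟩ := hL
  obtain ⟨hm', hd'⟩ := monic_raise hm (α j) 1
  refine ⟨hm', by rw [hd', hd, sum_add_unitIndex], hw'.isMultipleOrthogonal_iff.2 fun i k hk => ?_⟩
  set β : ℝ := (α - unitVector j) i with hβ
  have hβ1 : -1 < β := by
    have := hα i
    by_cases hij : i = j
    · subst hij
      simp only [hβ, unitVector, Pi.sub_apply, Pi.single_eq_same]
      linarith
    · simp only [hβ, unitVector, Pi.sub_apply, Pi.single_eq_of_ne hij]
      linarith
  have hparts : hw'.moment i (X * derivative (X ^ k * L) + C (β + 1) * (X ^ k * L) -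
      C 1 * X * (X ^ k * L)) = 0 := by
    refine Eq.trans ?_ (integral_gammaWeight_by_parts hβ1 one_pos (X ^ k * L))
    rw [IsChebyshevSystem.moment_apply]
    simp only [laguerreWeightFirst, one_mul, hβ]
  -- For `i = j` the factor equals `k`: it kills `k = 0`, and for `k > 0` one power of `x` moves
  -- into the weight. For `i ≠ j` the weight is unchanged and `k < n i`.
  have hlower : (β + 1 + k - α j) * hw'.moment i (X ^ k * L) = 0 := by
    by_cases hij : i = j
    · subst hij
      cases k with
      | zero => simp [hβ, unitVector]
      | succ k =>
        refine mul_eq_zero_of_right _ ?_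
        rw [← ho i k (by simpa [unitIndex] using hk), IsChebyshevSystem.moment_apply]
        refine setIntegral_congr_fun measurableSet_Ioi fun x hx => ?_
        have hx : x ≠ 0 := ne_of_gt hx
        have : x ^ α i = x ^ (α i - 1) * x := by
          rw [← Real.rpow_add_one hx, sub_add_cancel]
        simp only [laguerreWeightFirst, unitVector, Pi.sub_apply, Pi.single_eq_same, eval_mul,
          eval_pow, eval_X, this]
        ring
    · refine mul_eq_zero_of_right _ ?_
      rw [← ho i k (by simpa [unitIndex, hij] using hk), IsChebyshevSystem.moment_apply]
      simp [laguerreWeightFirst, unitVector, hij]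
  have hdecomp : X ^ k * raise (α j) 1 L = (β + 1 + k - α j) • (X ^ k * L) -
      (X * derivative (X ^ k * L) + C (β + 1) * (X ^ k * L) - C 1 * X * (X ^ k * L)) := by
    rw [X_mul_derivative_X_pow_mul, raise, smul_eq_C_mul]
    simp only [map_add, map_sub, C_1]
    ring
  rw [hdecomp, map_sub, map_smul, hparts, smul_eq_mul, hlower, sub_zero]

/-- Integrating by parts with rate `c i` instead of `c j` leaves an extra term `(c j - c i) X^(k+1)
L`. It vanishes for `i = j`, and for `i ≠ j` by orthogonality of `L`. -/
theorem isTypeIIOrthogonal_raise_second {r : ℕ} {α : ℝ} {c : Fin r → ℝ} (hα : 0 < α)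
    (hc : ∀ i, 0 < c i) {j : Fin r}
    (hw' : IsChebyshevSystem (laguerreWeightSecond (α - 1) c)) {n : Fin r → ℕ} {L : ℝ[X]}
    (hL : IsTypeIIOrthogonal (laguerreWeightSecond α c) n L) :
    IsTypeIIOrthogonal (laguerreWeightSecond (α - 1) c) (n + unitIndex j)
      (raise (α / c j) (c j)⁻¹ L) := by
  obtain ⟨hm, hd, ho⟩ := hL
  obtain ⟨hm', hd'⟩ := monic_raise hm (α / c j) (c j)⁻¹
  refine ⟨hm', by rw [hd', hd, sum_add_unitIndex], hw'.isMultipleOrthogonal_iff.2 fun i k hk => ?_⟩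
  have hparts : hw'.moment i (X * derivative (X ^ k * L) + C (α - 1 + 1) * (X ^ k * L) -
      C (c i) * X * (X ^ k * L)) = 0 := by
    exact integral_gammaWeight_by_parts (by linarith : -1 < α - 1) (hc i) (X ^ k * L)
  have hshift : ∀ l, l < n i → hw'.moment i (X ^ (l + 1) * L) = 0 := fun l hl => by
    rw [← ho i l hl, IsChebyshevSystem.moment_apply]
    refine setIntegral_congr_fun measurableSet_Ioi fun x hx => ?_
    have hx : x ≠ 0 := ne_of_gt hx
    have : x ^ α = x ^ (α - 1) * x := by
      rw [← Real.rpow_add_one hx, sub_add_cancel]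
    simp only [laguerreWeightSecond, eval_mul, eval_pow, eval_X, this]
    ring
  have hlower : (k : ℝ) * hw'.moment i (X ^ k * L) = 0 := by
    cases k with
    | zero => simp
    | succ k =>
      refine mul_eq_zero_of_right _ (hshift k ?_)
      by_cases hij : i = j
      · subst hij
        simpa [unitIndex] using hk
      · exact k.lt_succ_self.trans (by simpa [unitIndex, hij] using hk)
  have hupper : (c j - c i) * hw'.moment i (X ^ (k + 1) * L) = 0 := by
    by_cases hij : i = j
    · simp [hij]
    · exact mul_eq_zero_of_right _ (hshift k (by simpa [unitIndex, hij] using hk))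
  have hcj := (hc j).ne'
  have hdecomp : X ^ k * raise (α / c j) (c j)⁻¹ L = (c j)⁻¹ • ((k : ℝ) • (X ^ k * L) +
      (c j - c i) • (X ^ (k + 1) * L) -
      (X * derivative (X ^ k * L) + C (α - 1 + 1) * (X ^ k * L) -
        C (c i) * X * (X ^ k * L))) := by
    have hC : C (c j)⁻¹ * C (c j) = 1 := by rw [← C_mul, inv_mul_cancel₀ hcj, C_1]
    rw [X_mul_derivative_X_pow_mul, raise, sub_add_cancel, div_eq_mul_inv]
    simp only [smul_eq_C_mul, map_sub, C_mul]
    linear_combination (-(X ^ (k + 1) * L)) * hC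
  rw [hdecomp, map_smul, map_sub, map_add, map_smul, map_smul, hparts, smul_eq_mul, smul_eq_mul,
    smul_eq_mul, hlower, hupper]
  simp

/-! ### The Turán inequalities -/

/-- A raising operator between two Chebyshev systems turns positivity of Wronskians into a
Turán inequality. -/
theorem IsChebyshevSystem.turan_pos {r : ℕ} {w w' : Fin r → ℝ → ℝ} (hw : IsChebyshevSystem w)
    (hw' : IsChebyshevSystem w') {a b : ℝ} (hb : 0 < b) {j : Fin r}
    (hraise : ∀ n L, IsTypeIIOrthogonal w n L →
      IsTypeIIOrthogonal w' (n + unitIndex j) (raise a b L))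
    {n : Fin r → ℕ} {k : Fin r} {A B A' B' : ℝ[X]} (hA : IsTypeIIOrthogonal w n A)
    (hB : IsTypeIIOrthogonal w (n + unitIndex k) B)
    (hA' : IsTypeIIOrthogonal w' (n + unitIndex j) A')
    (hB' : IsTypeIIOrthogonal w' (n + unitIndex j + unitIndex k) B') {x : ℝ} (hx : 0 < x) :
    B.eval x * A'.eval x - A.eval x * B'.eval x > 0 := by
  rw [add_right_comm] at hB'
  rw [hw'.isTypeIIOrthogonal_unique hA' (hraise _ _ hA),
    hw'.isTypeIIOrthogonal_unique hB' (hraise _ _ hB)]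
  have h := mul_pos (mul_pos hb hx) (hw.eval_wronskian_pos hA hB hx)
  refine h.trans_eq ?_
  simp only [raise, wronskian, eval_sub, eval_mul, eval_X, eval_C]
  ring

theorem theorem4p4 (r : ℕ) :
    -- first kind: existence and uniqueness of the polynomials
    (∀ α : Fin r → ℝ, (∀ i, -1 < α i) →
      (∀ i j, i ≠ j → ∀ m : ℤ, α i - α j ≠ (m : ℝ)) →
      ∀ n : Fin r → ℕ, ∃! P : ℝ[X], IsTypeIIOrthogonal (laguerreWeightFirst α) n P) ∧
    -- first kind: the inequality
    (∀ α : Fin r → ℝ, (∀ i, 0 < α i) →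
      (∀ i j, i ≠ j → ∀ m : ℤ, α i - α j ≠ (m : ℝ)) →
      ∀ (n : Fin r → ℕ) (j k : Fin r) (x : ℝ), 0 < x →
        (multipleLaguerreFirst α (n + unitIndex k)).eval x *
            (multipleLaguerreFirst (α - unitVector j) (n + unitIndex j)).eval x -
          (multipleLaguerreFirst α n).eval x *
            (multipleLaguerreFirst (α - unitVector j)
              (n + unitIndex j + unitIndex k)).eval x > 0) ∧
    -- second kind: existence and uniqueness of the polynomials
    (∀ (α : ℝ) (c : Fin r → ℝ), -1 < α → (∀ i, 0 < c i) →
      (∀ i j, i ≠ j → c i ≠ c j) →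
      ∀ n : Fin r → ℕ, ∃! P : ℝ[X], IsTypeIIOrthogonal (laguerreWeightSecond α c) n P) ∧
    -- second kind: the inequality
    (∀ (α : ℝ) (c : Fin r → ℝ), 0 < α → (∀ i, 0 < c i) →
      (∀ i j, i ≠ j → c i ≠ c j) →
      ∀ (n : Fin r → ℕ) (j k : Fin r) (x : ℝ), 0 < x →
        (multipleLaguerreSecond α c (n + unitIndex k)).eval x *
            (multipleLaguerreSecond (α - 1) c (n + unitIndex j)).eval x -
          (multipleLaguerreSecond α c n).eval x *
            (multipleLaguerreSecond (α - 1) c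
              (n + unitIndex j + unitIndex k)).eval x > 0) := by
  refine ⟨fun α hα hne n =>
    (isChebyshevSystem_laguerreWeightFirst hα hne).existsUnique_isTypeIIOrthogonal n,
    fun α hα hne n j k x hx => ?_, fun α c hα hc hne n =>
    (isChebyshevSystem_laguerreWeightSecond hα hc hne).existsUnique_isTypeIIOrthogonal n,
    fun α c hα hc hne n j k x hx => ?_⟩
  · have hw := isChebyshevSystem_laguerreWeightFirst (fun i => (by linarith [hα i] : -1 < α i)) hne
    have hw' : IsChebyshevSystem (laguerreWeightFirst (α - unitVector j)) := by
      refine isChebyshevSystem_laguerreWeightFirst (fun i => ?_) fun i l hil m h => ?_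
      · have := hα i
        by_cases hij : i = j
        · subst hij
          simp only [unitVector, Pi.sub_apply, Pi.single_eq_same]
          linarith
        · simp only [unitVector, Pi.sub_apply, Pi.single_eq_of_ne hij]
          linarith
      -- Subtracting `e_j` changes the differences of the parameters by integers, so they stay
      -- non-integral.
      · refine hne i l hil (m + (Pi.single j 1 : Fin r → ℤ) i - (Pi.single j 1 : Fin r → ℤ) l) ?_
        have hcast : ∀ i, unitVector j i = (((Pi.single j 1 : Fin r → ℤ) i : ℤ) : ℝ) := fun i => by
          by_cases hij : i = j
          · subst hij
            simp [unitVector]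
          · simp [unitVector, hij]
        rw [Pi.sub_apply, Pi.sub_apply, hcast, hcast] at h
        push_cast
        linarith
    exact hw.turan_pos hw' one_pos (fun n L => isTypeIIOrthogonal_raise_first hα hw')
      (hw.isTypeIIOrthogonal_epsilon _) (hw.isTypeIIOrthogonal_epsilon _)
      (hw'.isTypeIIOrthogonal_epsilon _) (hw'.isTypeIIOrthogonal_epsilon _) hx
  · have hw := isChebyshevSystem_laguerreWeightSecond (by linarith : -1 < α) hc hne
    have hw' := isChebyshevSystem_laguerreWeightSecond (by linarith : -1 < α - 1) hc hne
    exact hw.turan_pos hw' (inv_pos.2 (hc j)) (fun n L => isTypeIIOrthogonal_raise_second hα hc hw')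
      (hw.isTypeIIOrthogonal_epsilon _) (hw.isTypeIIOrthogonal_epsilon _)
      (hw'.isTypeIIOrthogonal_epsilon _) (hw'.isTypeIIOrthogonal_epsilon _) hx
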